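/- Let $q\in\mathbb C$ with $0<|q|<1$. Write $(x;q)_\infty=\prod_{j\ge 0}(1-xq^j)$, and for $k\in\mathbb Z$ write $(x;q)_k=(x;q)_\infty/(xq^k;q)_\infty$, common factors being cancelled; that is, for $n\ge 0$, $(x;q)_n=\prod_{j=0}^{n-1}(1-xq^j)$ and $(x;q)_{-n}=\prod_{j=1}^{n}(1-xq^{-j})^{-1}$. Put $(x_1,\dots,x_m;q)_k=(x_1;q)_k\cdots(x_m;q)_k$ for $k\in\mathbb Z\cup\{\infty\}$, and $$ {}_r\psi_s\!\left[\begin{matrix}a_1,\dots,a_r\\ b_1,\dots,b_s\end{matrix};q,z\right]=\sum_{k=-\infty}^{\infty}\frac{(a_1,\dots,a_r;q)_k}{(b_1,\dots,b_s;q)_k}\left((-1)^kq^{\binom k2}\right)^{s-r}z^k . $$ Let $a,b,c,d,e$ be nonzero complex numbers, let $\sqrt a$ be either square root of $a$, and suppose that the terms of the series below and the quotient of products below are well defined, that is: $a\ne q^{2n}$ for all $n\in\mathbb Z$ and, for each $x\in\{b,c,d,e\}$, $x\neq q^{n+1}$ and $aq/x\neq q^{-n}$ for all integers $n\ge 0$.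 Suppose further that either $|a^2q/bcde|<1$, or the series below terminates (only finitely many of its terms are nonzero) and $a^2q/bcde\ne q^{-n}$ for all integers $n\ge 0$. Then the bilateral series below converges absolutely, and (Bailey's very-well-poised ${}_6\psi_6$ summation) $$ {}_6\psi_6\!\left[\begin{matrix}q\sqrt a,-q\sqrt a,b,c,d,e\\ \sqrt a,-\sqrt a,aq/b,aq/c,aq/d,aq/e\end{matrix};q,\frac{a^2q}{bcde}\right] =\frac{(aq,aq/bc,aq/bd,aq/be,aq/cd,aq/ce,aq/de,q,q/a;q)_\infty}{(aq/b,aq/c,aq/d,aq/e,q/b,q/c,q/d,q/e,a^2q/bcde;q)_\infty}. $$ -/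

import Mathlib

/-- The infinite `q`-shifted factorial `(a; q)_∞ = ∏_{j ≥ 0} (1 - a q ^ j)`. -/
noncomputable def qPochInf (a q : ℂ) : ℂ :=
  ∏' j : ℕ, (1 - a * q ^ j)

/-- The `q`-shifted factorial `(a; q)_k` for an integer `k`, that is `(a; q)_∞ / (a q ^ k; q)_∞`
with the common factors cancelled (see `qPoch_eq_div`), so that it also makes sense when
`(a; q)_∞ = 0`: `(a; q)_n = ∏_{0 ≤ j < n} (1 - a q ^ j)` and
`(a; q)_{-n} = 1 / ∏_{1 ≤ j ≤ n} (1 - a q ^ (-j))` for natural numbers `n`.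
If `a = q ^ m` with `1 ≤ m ≤ n`, then `(a; q)_{-n}` is a pole; its value here is `0`, and so
its reciprocal has the right value `0`. -/
noncomputable def qPoch (a q : ℂ) : ℤ → ℂ
  | Int.ofNat n => ∏ j ∈ Finset.range n, (1 - a * q ^ j)
  | Int.negSucc n => (∏ j ∈ Finset.range (n + 1), (1 - a * (q ^ (j + 1))⁻¹))⁻¹

/-- `(a₁, …, a_m; q)_∞ = (a₁; q)_∞ ⋯ (a_m; q)_∞`. -/
noncomputable def qPochInfList (as : List ℂ) (q : ℂ) : ℂ :=
  (as.map fun a => qPochInf a q).prod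

/-- `(a₁, …, a_m; q)_k = (a₁; q)_k ⋯ (a_m; q)_k`. -/
noncomputable def qPochList (as : List ℂ) (q : ℂ) (k : ℤ) : ℂ :=
  (as.map fun a => qPoch a q k).prod

/-- The `k`-th term of the bilateral basic hypergeometric series `_rψ_s` with upper parameters
`as`, lower parameters `bs`, base `q` and argument `z`. (The division of `k * (k - 1)` by `2` is
exact.) -/
noncomputable def psiTerm (as bs : List ℂ) (q z : ℂ) (k : ℤ) : ℂ :=
  qPochList as q k / qPochList bs q k *
    ((-1) ^ k * q ^ (k * (k - 1) / 2)) ^ ((bs.length : ℤ) - (as.length : ℤ)) * z ^ k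

/-- The bilateral basic hypergeometric series `_rψ_s`, summed over all integers. -/
noncomputable def psi (as bs : List ℂ) (q z : ℂ) : ℂ :=
  ∑' k : ℤ, psiTerm as bs q z k

/-- The series has only finitely many nonzero terms. -/
def PsiTerminates (as bs : List ℂ) (q z : ℂ) : Prop :=
  (Function.support (psiTerm as bs q z)).Finite

/-- The infinite product that defines `(a; q)_∞` converges for `|q| < 1`. -/
theorem multipliable_qPochInf (a q : ℂ) (hq : ‖q‖ < 1) :
    Multipliable fun j : ℕ => 1 - a * q ^ j := by
  have h : Summable fun j : ℕ => ‖-(a * q ^ j)‖ := by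
    simp only [norm_neg, norm_mul, norm_pow]
    exact (summable_geometric_of_lt_one (norm_nonneg q) hq).mul_left _
  simpa [sub_eq_add_neg] using multipliable_one_add_of_summable h

theorem qPochInf_eq_prod_mul (a q : ℂ) (hq : ‖q‖ < 1) (n : ℕ) :
    qPochInf a q = (∏ j ∈ Finset.range n, (1 - a * q ^ j)) * qPochInf (a * q ^ n) q := by
  induction n with
  | zero => simp
  | succ n ih =>
    have h : qPochInf (a * q ^ n) q = (1 - a * q ^ n) * qPochInf (a * q ^ (n + 1)) q := by
      unfold qPochInf
      have hm : Multipliable fun j : ℕ => 1 - a * q ^ n * q ^ (j + 1) := by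
        have e : (fun j : ℕ => 1 - a * q ^ n * q ^ (j + 1)) =
            fun j : ℕ => 1 - a * q ^ (n + 1) * q ^ j := by
          funext j
          ring
        rw [e]
        exact multipliable_qPochInf (a * q ^ (n + 1)) q hq
      rw [tprod_eq_zero_mul' (f := fun j : ℕ => 1 - a * q ^ n * q ^ j) hm]
      simp only [pow_zero, mul_one]
      congr 1
      refine tprod_congr fun j => ?_
      ring
    rw [ih, h, Finset.prod_range_succ, mul_assoc]

/-- `(a; q)_k = (a; q)_∞ / (a q ^ k; q)_∞` whenever this quotient is defined. -/
theorem qPoch_eq_div (a q : ℂ) (hq0 : q ≠ 0) (hq : ‖q‖ < 1) (k : ℤ)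
    (h : qPochInf (a * q ^ k) q ≠ 0) :
    qPoch a q k = qPochInf a q / qPochInf (a * q ^ k) q := by
  rw [eq_div_iff h]
  cases k with
  | ofNat n => simpa [qPoch] using (qPochInf_eq_prod_mul a q hq n).symm
  | negSucc n =>
    have e := qPochInf_eq_prod_mul (a * q ^ (Int.negSucc n)) q hq (n + 1)
    have ha : a * q ^ (Int.negSucc n) * q ^ (n + 1) = a := by
      rw [zpow_negSucc, mul_assoc, inv_mul_cancel₀ (pow_ne_zero _ hq0), mul_one]
    have hp : (∏ j ∈ Finset.range (n + 1), (1 - a * q ^ (Int.negSucc n) * q ^ j)) =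
        ∏ j ∈ Finset.range (n + 1), (1 - a * (q ^ (j + 1))⁻¹) := by
      rw [← Finset.prod_range_reflect]
      refine Finset.prod_congr rfl fun j hj => ?_
      have hj' : j ≤ n := by have := Finset.mem_range.mp hj; omega
      have e1 : q ^ (n + 1) = q ^ (n + 1 - 1 - j) * q ^ (j + 1) := by
        rw [← pow_add]; congr 1; omega
      rw [zpow_negSucc, e1]
      field_simp
    rw [ha, hp] at e
    rw [e] at h ⊢
    have h1 := left_ne_zero_of_mul h
    simp only [qPoch]
    rw [inv_mul_cancel_left₀ h1]

/-!
Bailey's `₆ψ₆` summation, by iterating a contiguous relation.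

In terms of the reciprocals `u, v, w, x` of the parameters `b, c, d, e` the summand (`vwpTerm`)
extends continuously to zero values, where it carries the factor `q ^ (2 k (k - 1))`. Let
`S (u, v, w, x)` be the sum. The key fact is that `S (u, v, w, x)` and `S (q u, v, w, x)` differ by
an elementary factor,
`(1 - a q u) (1 - q u) (1 - a² q u v w x) S (u, v, w, x) =
  (1 - a q u v) (1 - a q u w) (1 - a q u x) S (q u, v, w, x)`,
because the difference of the summands telescopes: with `t = q ^ k` this is the polynomial identity
`telescoping_identity`, and the sums of the telescoping terms over all integers cancel
(`vwpTerm_contiguous`, `tsum_vwpTerm_contiguous`). The product side satisfies the same relation.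
The relation needs only the summability of the series, which it transmits from `u` to `q u`, so
terminating series and series with small argument are treated alike.

Applying the relation `n` times in each of the four parameters and letting `n → ∞`, where dominated
convergence applies (`tendsto_tsum_vwpTerm`), shows that `S` is the expected quotient of products
times `S (0, 0, 0, 0)` (`tsum_vwpTerm_mul_vwpDenom`). The constant `S (0, 0, 0, 0)` is a form of
Jacobi's triple product, and the relation just obtained also yields its value
(`tsum_vwpTerm_zero_params`): for `u = 1` and `v = 1 / a` only the term `k = 0` survives. This
choice has a pole if `a` is a power of `q`; the exponent is then odd and the series is antisymmetric.
-/

open Filter Topology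

/-! ### Shifted factorials with reciprocal parameters -/

/-- `u ^ k * (1 / u; q)_k`, as a function of `u` that also makes sense (as the limit) at `u = 0`. -/
noncomputable def recipPoch (u q : ℂ) : ℤ → ℂ
  | Int.ofNat n => ∏ j ∈ Finset.range n, (u - q ^ j)
  | Int.negSucc n => (∏ j ∈ Finset.range (n + 1), (u - (q ^ (j + 1))⁻¹))⁻¹

/-- The parameter `1 / u` causes no pole in the very-well-poised series: `1 / u ≠ q ^ (n + 1)` and
`a q u ≠ q ^ (-n)` for all natural numbers `n`. -/
def IsRegularParam (a q u : ℂ) : Prop :=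
  ∀ n : ℕ, u * q ^ (n + 1) ≠ 1 ∧ a * u * q ^ (n + 1) ≠ 1

/-- `u ^ k * (1 / u; q)_k / (a q u; q)_k`. -/
noncomputable def vwpFactor (a q u : ℂ) (k : ℤ) : ℂ :=
  recipPoch u q k * (qPoch (a * u * q) q k)⁻¹

/-- The `k`-th term of the very-well-poised `₆ψ₆` series, in terms of the reciprocals `u, v, w, x`
of the parameters `b, c, d, e`. It extends continuously to zero values of these reciprocals. -/
noncomputable def vwpTerm (a q u v w x : ℂ) (k : ℤ) : ℂ :=
  (1 - a * q ^ (2 * k)) / (1 - a) *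
    (vwpFactor a q u k * vwpFactor a q v k * vwpFactor a q w k * vwpFactor a q x k) *
    (a ^ 2 * q) ^ k

/-- The identity behind the contiguous relation, with `t` in the role of `q ^ k`. -/
theorem telescoping_identity (a q t u v w x : ℂ) :
    (1 - a * t ^ 2) * ((1 - a ^ 2 * q * (u * v * w * x)) * (q * u - t) * (1 - a * u * q * t) +
      t * ((1 - a * q * (u * v)) * (1 - a * q * (u * w)) * (1 - a * q * (u * x)))) =
    q * u * ((1 - a * u * q * t) * ((1 - a * v * t) * (1 - a * w * t) * (1 - a * x * t)) -
      a ^ 2 * (q * u - t) * ((v - t) * (w - t) * (x - t))) := by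
  ring

section Recurrences

variable {a q u x : ℂ}

theorem IsRegularParam.mul (h : IsRegularParam a q u) (m : ℕ) :
    IsRegularParam a q (q ^ m * u) := fun n =>
  ⟨fun e => (h (n + m)).1 (by rw [← e]; ring), fun e => (h (n + m)).2 (by rw [← e]; ring)⟩

theorem IsRegularParam.reflect (ha : a ≠ 0) (h : IsRegularParam a q u) :
    IsRegularParam a⁻¹ q (a * u) := fun n =>
  ⟨(h n).2, by rw [inv_mul_cancel_left₀ ha]; exact (h n).1⟩

theorem isRegularParam_zero : IsRegularParam a q 0 := fun n => by simp

theorem recipPoch_zero : recipPoch u q 0 = 1 := Finset.prod_range_zero _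

theorem qPoch_zero : qPoch x q 0 = 1 := Finset.prod_range_zero _

theorem sub_zpow_neg_ne_zero (hq : q ≠ 0) (hu : ∀ n : ℕ, u * q ^ (n + 1) ≠ 1) (n : ℕ) :
    u - q ^ (-(n : ℤ) - 1) ≠ 0 := fun h => hu n (by
  rw [sub_eq_zero.mp h, ← zpow_natCast, ← zpow_add₀ hq]
  simp)

theorem recipPoch_natCast (n : ℕ) :
    recipPoch u q n = ∏ j ∈ Finset.range n, (u - q ^ j) := rfl

theorem recipPoch_neg (n : ℕ) :
    recipPoch u q (-n) = (∏ j ∈ Finset.range n, (u - (q ^ (j + 1))⁻¹))⁻¹ := by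
  cases n with
  | zero => simp [recipPoch_zero]
  | succ n => rfl

theorem qPoch_natCast (n : ℕ) :
    qPoch x q n = ∏ j ∈ Finset.range n, (1 - x * q ^ j) := rfl

theorem qPoch_neg (n : ℕ) :
    qPoch x q (-n) = (∏ j ∈ Finset.range n, (1 - x * (q ^ (j + 1))⁻¹))⁻¹ := by
  cases n with
  | zero => simp [qPoch_zero]
  | succ n => rfl

theorem recipPoch_add_one (hq : q ≠ 0) (hu : ∀ n : ℕ, u * q ^ (n + 1) ≠ 1) (k : ℤ) :
    recipPoch u q (k + 1) = (u - q ^ k) * recipPoch u q k := by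
  induction k with
  | zero => simpa [recipPoch_zero] using recipPoch_natCast (u := u) (q := q) 1
  | succ n _ =>
    have h := recipPoch_natCast (u := u) (q := q) (n + 2)
    rw [Finset.prod_range_succ, ← recipPoch_natCast] at h
    push_cast at h
    rw [add_assoc, one_add_one_eq_two, h, mul_comm]
    norm_cast
  | pred n _ =>
    have h := recipPoch_neg (u := u) (q := q) (n + 1)
    rw [Finset.prod_range_succ, mul_inv, ← recipPoch_neg] at h
    have e : (q ^ (n + 1))⁻¹ = q ^ (-(n : ℤ) - 1) := by
      rw [← zpow_natCast, ← zpow_neg]; congr 1; push_cast; ring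
    rw [e] at h
    have h0 := sub_zpow_neg_ne_zero hq hu n
    push_cast at h
    rw [sub_add_cancel, ← neg_add', h]
    rw [neg_add']
    field_simp

/-- The functional equation of `1 / (x; q)_k`. Unlike that of `(x; q)_k`, it also holds at the poles
with negative index. -/
theorem inv_qPoch_eq_mul (hx : ∀ n : ℕ, x * q ^ n ≠ 1) (k : ℤ) :
    (qPoch x q k)⁻¹ = (1 - x * q ^ k) * (qPoch x q (k + 1))⁻¹ := by
  have hx' (n : ℕ) : 1 - x * q ^ n ≠ 0 := sub_ne_zero.mpr (hx n).symm
  induction k with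
  | zero =>
    have h := qPoch_natCast (x := x) (q := q) 1
    have := hx' 0
    simp only [Finset.prod_range_one, Nat.cast_one] at h
    rw [zero_add, zpow_zero, qPoch_zero, h, inv_one, mul_one]
    rw [pow_zero, mul_one] at this ⊢
    exact (mul_inv_cancel₀ this).symm
  | succ n _ =>
    have h := qPoch_natCast (x := x) (q := q) (n + 2)
    rw [Finset.prod_range_succ, ← qPoch_natCast] at h
    push_cast at h
    have := hx' (n + 1)
    rw [add_assoc, one_add_one_eq_two, h, mul_inv]
    have e : q ^ ((n : ℤ) + 1) = q ^ (n + 1) := by norm_cast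
    rw [e]
    field_simp
  | pred n _ =>
    have h := qPoch_neg (x := x) (q := q) (n + 1)
    rw [Finset.prod_range_succ, mul_inv, ← qPoch_neg] at h
    have e : (q ^ (n + 1))⁻¹ = q ^ (-(n : ℤ) - 1) := by
      rw [← zpow_natCast, ← zpow_neg]; congr 1; push_cast; ring
    rw [e] at h
    push_cast at h
    rw [sub_add_cancel, ← neg_add', h, mul_inv, inv_inv, mul_comm, neg_add']

theorem recipPoch_base_mul (hq : q ≠ 0) (hu : ∀ n : ℕ, u * q ^ (n + 1) ≠ 1) (k : ℤ) :
    recipPoch (q * u) q k = q ^ (k - 1) * (q * u - 1) * recipPoch u q (k - 1) := by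
  have hu' (n : ℕ) : q * u * q ^ (n + 1) ≠ 1 := fun e => hu (n + 1) (by rw [← e]; ring)
  have hrec (k : ℤ) := recipPoch_add_one hq hu' k
  have hrec' (k : ℤ) := recipPoch_add_one hq hu (k - 1)
  simp only [sub_add_cancel] at hrec'
  have key (k : ℤ) : (q * u - q ^ k) * q ^ (k - 1) = (u - q ^ (k - 1)) * q ^ k := by
    rw [zpow_sub_one₀ hq]; field_simp
  induction k with
  | zero =>
    have h := hrec' 0
    have h1 : u * q - 1 ≠ 0 := sub_ne_zero.mpr (by simpa using hu 0)
    rw [recipPoch_zero, zero_sub, zpow_neg_one] at h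
    rw [recipPoch_zero, zero_sub, zpow_neg_one]
    calc (1 : ℂ) = (u - q⁻¹) * recipPoch u q (-1) := h
      _ = _ := by field_simp
  | succ n ih =>
    rw [hrec, ih, add_sub_cancel_right, hrec' n]
    linear_combination (q * u - 1) * recipPoch u q (n - 1) * key n
  | pred n ih =>
    have h0 := sub_zpow_neg_ne_zero hq hu' n
    have h1 := hrec (-n - 1)
    have h2 := hrec' (-n - 1)
    rw [sub_add_cancel] at h1
    apply mul_left_cancel₀ h0
    rw [← h1, ih, h2]
    linear_combination -(q * u - 1) * recipPoch u q (-n - 1 - 1) * key (-n - 1)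

theorem inv_qPoch_mul_base (hq : q ≠ 0) (hx : ∀ n : ℕ, x * q ^ n ≠ 1) (k : ℤ) :
    (qPoch (x * q) q k)⁻¹ = (1 - x) * (qPoch x q (k + 1))⁻¹ := by
  have hx' (n : ℕ) : x * q * q ^ n ≠ 1 := fun e => hx (n + 1) (by rw [← e]; ring)
  have hrec (k : ℤ) := inv_qPoch_eq_mul hx' k
  have hrec' (k : ℤ) := inv_qPoch_eq_mul hx (k + 1)
  have key (k : ℤ) : x * q * q ^ k = x * q ^ (k + 1) := by rw [zpow_add_one₀ hq]; ring
  induction k with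
  | zero =>
    have := inv_qPoch_eq_mul hx 0
    simpa [qPoch_zero] using this
  | succ n ih =>
    have h0 : 1 - x * q * q ^ (n : ℤ) ≠ 0 := sub_ne_zero.mpr (by
      rw [zpow_natCast]; exact (hx' n).symm)
    apply mul_left_cancel₀ h0
    rw [← hrec, ih, hrec', key]
    ring
  | pred n ih =>
    have h := hrec' (-n - 1)
    rw [sub_add_cancel] at h
    rw [hrec, sub_add_cancel, ih, key, sub_add_cancel, h]
    ring

theorem IsRegularParam.mul_ne_one (h : IsRegularParam a q u) (n : ℕ) : a * u * q * q ^ n ≠ 1 :=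
  fun e => (h n).2 (by rw [← e]; ring)

theorem IsRegularParam.inv_qPoch_sub_one (hq : q ≠ 0) (h : IsRegularParam a q u) (k : ℤ) :
    (qPoch (a * u * q) q (k - 1))⁻¹ = (1 - a * u * q ^ k) * (qPoch (a * u * q) q k)⁻¹ := by
  have h' := inv_qPoch_eq_mul h.mul_ne_one (k - 1)
  rw [sub_add_cancel, zpow_sub_one₀ hq] at h'
  rw [h']
  congr 1
  field_simp

theorem vwpFactor_zero : vwpFactor a q u 0 = 1 := by
  simp [vwpFactor, recipPoch_zero, qPoch_zero]

theorem vwpFactor_natCast_succ (n : ℕ) :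
    vwpFactor a q u (n + 1 : ℕ) =
      (u - q ^ n) / (1 - a * u * q * q ^ n) * vwpFactor a q u n := by
  simp only [vwpFactor, recipPoch_natCast, qPoch_natCast, Finset.prod_range_succ, mul_inv,
    div_eq_mul_inv]
  ring

theorem vwpFactor_mul_eq (hq : q ≠ 0) (h : IsRegularParam a q u) (k : ℤ) :
    vwpFactor a q u k * (u - q ^ k) =
      vwpFactor a q u (k + 1) * (1 - a * u * q * q ^ k) := by
  simp only [vwpFactor]
  rw [recipPoch_add_one hq (fun n => (h n).1), inv_qPoch_eq_mul h.mul_ne_one]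
  ring

/-- The reflection `k ↦ -k` exchanges `a` with `1 / a` and `u` with `a u`. -/
theorem vwpFactor_neg (hq : q ≠ 0) (ha : a ≠ 0) (h : IsRegularParam a q u) (n : ℕ) :
    vwpFactor a q u (-n) = q ^ n * vwpFactor a⁻¹ q (a * u) n := by
  induction n with
  | zero => simp [vwpFactor_zero]
  | succ n ih =>
    have h0 := sub_zpow_neg_ne_zero hq (fun n => (h n).1) n
    have h1 := vwpFactor_mul_eq hq h (-n - 1)
    rw [sub_add_cancel, ih] at h1
    have e : (-((n + 1 : ℕ) : ℤ)) = -n - 1 := by push_cast; ring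
    rw [vwpFactor_natCast_succ, e]
    apply mul_right_cancel₀ h0
    rw [h1, inv_mul_cancel_left₀ ha]
    have e2 : q ^ (-(n : ℤ) - 1) = (q ^ n * q)⁻¹ := by
      rw [← pow_succ, ← zpow_natCast, ← zpow_neg]; congr 1; push_cast; ring
    have h3 : 1 - q ^ n * u * q ≠ 0 := sub_ne_zero.mpr fun e => (h n).1 (by rw [e]; ring)
    have h4 := pow_ne_zero n hq
    rw [e2, pow_succ]
    generalize q ^ n = t at *
    generalize vwpFactor a⁻¹ q (a * u) n = f
    field_simp
    ring

end Recurrences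

/-! ### The terms of the series and the telescoping certificate -/

section TermIdentities

variable {a q u v w x : ℂ}

theorem vwpTerm_rotate (a q u v w x : ℂ) (k : ℤ) :
    vwpTerm a q u v w x k = vwpTerm a q v w x u k := by
  simp only [vwpTerm]
  ring

theorem vwpTerm_zero (ha1 : a ≠ 1) : vwpTerm a q u v w x 0 = 1 := by
  simp [vwpTerm, vwpFactor_zero, div_self (sub_ne_zero.mpr ha1.symm)]

/-- The reflection `k ↦ -k` of the series exchanges `a` with `1 / a` and multiplies the reciprocal
parameters by `a`. -/
theorem vwpTerm_neg (hq : q ≠ 0) (ha : a ≠ 0) (ha1 : a ≠ 1) (hu : IsRegularParam a q u)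
    (hv : IsRegularParam a q v) (hw : IsRegularParam a q w) (hx : IsRegularParam a q x) (n : ℕ) :
    vwpTerm a q u v w x (-n) = vwpTerm a⁻¹ q (a * u) (a * v) (a * w) (a * x) n := by
  simp only [vwpTerm, vwpFactor_neg hq ha hu, vwpFactor_neg hq ha hv, vwpFactor_neg hq ha hw,
    vwpFactor_neg hq ha hx]
  have h1 : 1 - a ≠ 0 := sub_ne_zero.mpr ha1.symm
  have h2 : a - 1 ≠ 0 := sub_ne_zero.mpr ha1
  have h3 : 1 - a⁻¹ ≠ 0 := sub_ne_zero.mpr fun e => ha1 (inv_eq_one.mp e.symm)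
  have h4 := pow_ne_zero n hq
  have h5 := pow_ne_zero n ha
  have e1 : q ^ (2 * -(n : ℤ)) = ((q ^ n) ^ 2)⁻¹ := by
    rw [← pow_mul, ← zpow_natCast, ← zpow_neg]; congr 1; push_cast; ring
  have e2 : q ^ (2 * (n : ℤ)) = (q ^ n) ^ 2 := by
    rw [← pow_mul, ← zpow_natCast]; congr 1; push_cast; ring
  have e3 : (a ^ 2 * q) ^ n = (a ^ n) ^ 2 * q ^ n := by ring
  have e4 : (a⁻¹ ^ 2 * q) ^ n = ((a ^ n) ^ 2)⁻¹ * q ^ n := by rw [mul_pow]; ring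
  rw [e1, e2, zpow_neg, zpow_natCast, zpow_natCast, e3, e4]
  generalize q ^ n = t at *
  generalize a ^ n = b at *
  generalize vwpFactor a⁻¹ q (a * u) n = f1
  generalize vwpFactor a⁻¹ q (a * v) n = f2
  generalize vwpFactor a⁻¹ q (a * w) n = f3
  generalize vwpFactor a⁻¹ q (a * x) n = f4
  field_simp
  ring

/-- The quotient of consecutive terms of the series, as a function of `t = q ^ k`. -/
noncomputable def vwpRatio (a q u v w x t : ℂ) : ℂ :=
  (1 - a * (q * t) ^ 2) / (1 - a * t ^ 2) * (a ^ 2 * q) *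
    ((u - t) / (1 - a * u * q * t) * ((v - t) / (1 - a * v * q * t)) *
      ((w - t) / (1 - a * w * q * t)) * ((x - t) / (1 - a * x * q * t)))

theorem vwpTerm_natCast_succ (ha : ∀ n : ℤ, a ≠ q ^ (2 * n)) (n : ℕ) :
    vwpTerm a q u v w x (n + 1 : ℕ) = vwpRatio a q u v w x (q ^ n) * vwpTerm a q u v w x n := by
  simp only [vwpTerm, vwpFactor_natCast_succ, vwpRatio]
  have h1 : 1 - a * (q ^ n) ^ 2 ≠ 0 := by
    intro e
    apply ha (-n)
    rw [mul_neg, zpow_neg]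
    refine eq_inv_of_mul_eq_one_left ?_
    rw [mul_comm 2, zpow_mul]
    norm_cast
    linear_combination -e
  have e1 : q ^ (2 * ((n + 1 : ℕ) : ℤ)) = (q * q ^ n) ^ 2 := by
    rw [← pow_succ', ← pow_mul, ← zpow_natCast]; congr 1; push_cast; ring
  have e2 : q ^ (2 * (n : ℤ)) = (q ^ n) ^ 2 := by
    rw [← pow_mul, ← zpow_natCast]; congr 1; push_cast; ring
  rw [e1, e2, zpow_natCast, zpow_natCast, pow_succ (a ^ 2 * q)]
  have h2 : (1 - a * (q * q ^ n) ^ 2) / (1 - a) = (1 - a * (q * q ^ n) ^ 2) /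
      (1 - a * (q ^ n) ^ 2) * ((1 - a * (q ^ n) ^ 2) / (1 - a)) := by
    rw [div_mul_div_cancel₀ h1]
  rw [h2]
  generalize (1 - a * (q * q ^ n) ^ 2) / (1 - a * (q ^ n) ^ 2) = r0
  generalize (u - q ^ n) / (1 - a * u * q * q ^ n) = r1
  generalize (v - q ^ n) / (1 - a * v * q * q ^ n) = r2
  generalize (w - q ^ n) / (1 - a * w * q * q ^ n) = r3
  generalize (x - q ^ n) / (1 - a * x * q * q ^ n) = r4
  ring

/-- The function of `k` whose differences give the contiguous relation `vwpTerm_contiguous`. Up to a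
constant it is `vwpTerm` without its very-well-poised factor, with the index shifted by one in the
numerator factor of `u` and in the denominator factors of `v`, `w` and `x`. -/
noncomputable def vwpCertificate (a q u v w x : ℂ) (k : ℤ) : ℂ :=
  (1 - a * u * q) * (1 - q * u) / (1 - a) * u * (recipPoch u q (k - 1) *
    (qPoch (a * u * q) q k)⁻¹) *
    ((recipPoch v q k * (qPoch (a * v * q) q (k - 1))⁻¹) *
    (recipPoch w q k * (qPoch (a * w * q) q (k - 1))⁻¹) *
    (recipPoch x q k * (qPoch (a * x * q) q (k - 1))⁻¹)) * (a ^ 2 * q) ^ k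

/-- Multiplying `u` by `q` changes each term only by an elementary factor. -/
theorem vwpTerm_base_mul_eq (hq : q ≠ 0) (hu : IsRegularParam a q u) (k : ℤ) :
    vwpTerm a q (q * u) v w x k * ((q * u - q ^ k) * (1 - a * u * q * q ^ k)) =
      vwpTerm a q u v w x k * (q ^ k * ((q * u - 1) * (1 - a * u * q))) := by
  have h1 := recipPoch_base_mul hq (fun n => (hu n).1) k
  have h2 := inv_qPoch_mul_base hq hu.mul_ne_one k
  have h3 := recipPoch_add_one hq (fun n => (hu n).1) (k - 1)
  have h4 := inv_qPoch_eq_mul hu.mul_ne_one k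
  have e : a * (q * u) * q = a * u * q * q := by ring
  rw [sub_add_cancel] at h3
  simp only [vwpTerm, vwpFactor]
  rw [e, h1, h2, h3, h4, zpow_sub_one₀ hq]
  generalize recipPoch u q (k - 1) = p1
  generalize (qPoch (a * u * q) q (k + 1))⁻¹ = p2
  generalize recipPoch v q k * (qPoch (a * v * q) q k)⁻¹ = p3
  generalize recipPoch w q k * (qPoch (a * w * q) q k)⁻¹ = p4
  generalize recipPoch x q k * (qPoch (a * x * q) q k)⁻¹ = p5
  generalize (1 - a * q ^ (2 * k)) / (1 - a) = p6
  generalize q ^ k = t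
  linear_combination (p6 * p1 * p2 * p3 * p4 * p5 * (a ^ 2 * q) ^ k * (q * u - 1) *
    (1 - a * u * q) * (1 - a * u * q * t) * t * u) * mul_inv_cancel₀ hq

/-- The summands of the two series in the contiguous relation differ by a telescoping term. -/
theorem vwpTerm_contiguous (hq : q ≠ 0) (ha : a ≠ 0) (hu : IsRegularParam a q u)
    (hv : IsRegularParam a q v) (hw : IsRegularParam a q w) (hx : IsRegularParam a q x) (k : ℤ) :
    (1 - a * u * q) * (1 - q * u) * (1 - a ^ 2 * q * (u * v * w * x)) * vwpTerm a q u v w x k -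
      (1 - a * q * (u * v)) * (1 - a * q * (u * w)) * (1 - a * q * (u * x)) *
        vwpTerm a q (q * u) v w x k =
      vwpCertificate a q u v w x k - vwpCertificate a q u v w x (k + 1) := by
  have h1 := recipPoch_base_mul hq (fun n => (hu n).1) k
  have h2 := inv_qPoch_mul_base hq hu.mul_ne_one k
  have h3 := recipPoch_add_one hq (fun n => (hu n).1) (k - 1)
  have h4 := inv_qPoch_eq_mul hu.mul_ne_one k
  have hP {y : ℂ} (hy : IsRegularParam a q y) := recipPoch_add_one hq (fun n => (hy n).1) k
  have hQ {y : ℂ} (hy : IsRegularParam a q y) := hy.inv_qPoch_sub_one hq k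
  have e : a * (q * u) * q = a * u * q * q := by ring
  have e1 : q ^ (2 * k) = (q ^ k) ^ 2 := by rw [mul_comm, zpow_mul]; norm_cast
  have key : (1 - a * (q ^ k) ^ 2) * ((1 - a ^ 2 * q * (u * v * w * x)) *
      (u - q ^ k * q⁻¹) * (1 - a * u * q * q ^ k) + q ^ k * q⁻¹ *
        ((1 - a * q * (u * v)) * (1 - a * q * (u * w)) * (1 - a * q * (u * x)))) =
      u * ((1 - a * u * q * q ^ k) * ((1 - a * v * q ^ k) * (1 - a * w * q ^ k) *
        (1 - a * x * q ^ k)) - a ^ 2 * q * (u - q ^ k * q⁻¹) *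
          ((v - q ^ k) * (w - q ^ k) * (x - q ^ k))) := by
    have h := telescoping_identity a q (q ^ k) u v w x
    have hB : q * u - q ^ k = q * (u - q ^ k * q⁻¹) := by field_simp
    apply mul_left_cancel₀ hq
    rw [hB] at h
    linear_combination h + (1 - a * (q ^ k) ^ 2) * q ^ k * ((1 - a * q * (u * v)) *
      (1 - a * q * (u * w)) * (1 - a * q * (u * x))) * mul_inv_cancel₀ hq
  rw [sub_add_cancel, zpow_sub_one₀ hq] at h3
  unfold vwpTerm vwpFactor vwpCertificate
  rw [e, h1, h2, add_sub_cancel_right, h4, h3, hP hv, hP hw, hP hx, hQ hv, hQ hw, hQ hx,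
    zpow_sub_one₀ hq, zpow_add_one₀ (mul_ne_zero (pow_ne_zero 2 ha) hq), e1]
  have e2 : 1 - q * u = -(q * u - 1) := by ring
  rw [e2]
  -- Once all factors are atoms, the claim is a multiple of `key`.
  generalize recipPoch u q (k - 1) = p1
  generalize (qPoch (a * u * q) q (k + 1))⁻¹ = p2
  generalize recipPoch v q k = p3
  generalize recipPoch w q k = p4
  generalize recipPoch x q k = p5
  generalize (qPoch (a * v * q) q k)⁻¹ = p6
  generalize (qPoch (a * w * q) q k)⁻¹ = p7
  generalize (qPoch (a * x * q) q k)⁻¹ = p8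
  generalize (a ^ 2 * q) ^ k = p9
  generalize 1 - a * (q ^ k) ^ 2 = d at *
  generalize 1 - a ^ 2 * q * (u * v * w * x) = z at *
  generalize u - q ^ k * q⁻¹ = u1 at *
  generalize v - q ^ k = v1 at *
  generalize w - q ^ k = w1 at *
  generalize x - q ^ k = x1 at *
  generalize 1 - a * u * q * q ^ k = u2 at *
  generalize 1 - a * v * q ^ k = v2 at *
  generalize 1 - a * w * q ^ k = w2 at *
  generalize 1 - a * x * q ^ k = x2 at *
  generalize 1 - a * q * (u * v) = v3 at *
  generalize 1 - a * q * (u * w) = w3 at *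
  generalize 1 - a * q * (u * x) = x3 at *
  generalize 1 - a * u * q = m1 at *
  generalize q * u - 1 = m2 at *
  linear_combination (-(m1 * m2 / (1 - a) * p1 * p2 * p3 * p4 * p5 * p6 * p7 * p8 * p9)) * key

end TermIdentities

/-! ### Convergence and the contiguous relation -/

section Convergence

variable {a q u v w x : ℂ}

theorem summable_nat_of_mul_eq (hq1 : ‖q‖ < 1) {F G : ℕ → ℂ} {d m : ℂ → ℂ}
    (hd : Continuous d) (hm : Continuous m) (hd0 : d 0 ≠ 0) (hG : Summable G)
    (h : ∀ n, F n * d (q ^ n) = G n * m (q ^ n)) : Summable F := by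
  have hq := tendsto_pow_atTop_nhds_zero_of_norm_lt_one hq1
  have hlim : Tendsto (fun n : ℕ => m (q ^ n) / d (q ^ n)) atTop (𝓝 (m 0 / d 0)) :=
    ((hm.tendsto 0).comp hq).div ((hd.tendsto 0).comp hq) hd0
  have hne : ∀ᶠ n : ℕ in atTop, d (q ^ n) ≠ 0 :=
    ((hd.tendsto 0).comp hq).eventually_ne hd0
  have hO := (Asymptotics.isBigO_refl G atTop).mul (hlim.isBigO_one ℂ)
  simp only [mul_one] at hO
  refine summable_of_isBigO_nat hG.norm ((hO.congr' ?_ EventuallyEq.rfl).norm_right)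
  filter_upwards [hne] with n hn
  rw [← mul_div_assoc, ← h, mul_div_cancel_right₀ _ hn]

/-- Comparison of two bilateral series whose terms differ by a rational function of `q ^ k` without
poles at `0` and `∞`. -/
theorem summable_int_of_mul_eq (hq1 : ‖q‖ < 1) {F G : ℤ → ℂ} {d m d' m' : ℂ → ℂ}
    (hd : Continuous d) (hm : Continuous m) (hd0 : d 0 ≠ 0)
    (hd' : Continuous d') (hm' : Continuous m') (hd0' : d' 0 ≠ 0) (hG : Summable G)
    (h : ∀ n : ℕ, F n * d (q ^ n) = G n * m (q ^ n))
    (h' : ∀ n : ℕ, F (-n) * d' (q ^ n) = G (-n) * m' (q ^ n)) : Summable F :=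
  .of_nat_of_neg
    (summable_nat_of_mul_eq hq1 hd hm hd0 (hG.comp_injective Nat.cast_injective) h)
    (summable_nat_of_mul_eq hq1 hd' hm' hd0'
      (hG.comp_injective (neg_injective.comp Nat.cast_injective)) h')

/-- Summability passes from `u` to `q u`, whatever the argument of the series. -/
theorem summable_vwpTerm_base_mul (hq0 : q ≠ 0) (hq1 : ‖q‖ < 1) (ha : a ≠ 0)
    (hu : IsRegularParam a q u) (hs : Summable (vwpTerm a q u v w x)) :
    Summable (vwpTerm a q (q * u) v w x) := by
  rcases eq_or_ne u 0 with rfl | hu0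
  · simpa using hs
  have key := vwpTerm_base_mul_eq (v := v) (w := w) (x := x) hq0 hu
  refine summable_int_of_mul_eq hq1
    (d := fun t => (q * u - t) * (1 - a * u * q * t))
    (m := fun t => t * ((q * u - 1) * (1 - a * u * q)))
    (d' := fun s => (q * u * s - 1) * (s - a * u * q))
    (m' := fun s => s * ((q * u - 1) * (1 - a * u * q)))
    (by fun_prop) (by fun_prop) (by simp [hq0, hu0]) (by fun_prop) (by fun_prop)
    (by simp [ha, hq0, hu0]) hs ?_ ?_
  · intro n
    simpa using key n
  · intro n
    have h := key (-n)
    have h0 := pow_ne_zero n hq0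
    rw [zpow_neg, zpow_natCast] at h
    generalize q ^ n = s at *
    generalize vwpTerm a q (q * u) v w x (-n) = T1 at *
    generalize vwpTerm a q u v w x (-n) = T2 at *
    field_simp at h
    linear_combination h

/-- The certificate is the summand times a rational function of `q ^ k`, which for `u ≠ 0` has no
pole at `0` and `∞`; so it is summable when the series is. -/
theorem vwpCertificate_mul_eq (hq : q ≠ 0) (hu : IsRegularParam a q u)
    (hv : IsRegularParam a q v) (hw : IsRegularParam a q w) (hx : IsRegularParam a q x) (k : ℤ) :
    vwpCertificate a q u v w x k * ((q * u - q ^ k) * (1 - a * (q ^ k) ^ 2)) =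
      vwpTerm a q u v w x k * ((1 - a * u * q) * (1 - q * u) * u * q *
        ((1 - a * v * q ^ k) * (1 - a * w * q ^ k) * (1 - a * x * q ^ k))) := by
  have h3 := recipPoch_add_one hq (fun n => (hu n).1) (k - 1)
  have hQ {y : ℂ} (hy : IsRegularParam a q y) := hy.inv_qPoch_sub_one hq k
  have e1 : q ^ (2 * k) = (q ^ k) ^ 2 := by rw [mul_comm, zpow_mul]; norm_cast
  have hB : q * u - q ^ k = q * (u - q ^ k * q⁻¹) := by field_simp
  rw [sub_add_cancel, zpow_sub_one₀ hq] at h3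
  unfold vwpTerm vwpFactor vwpCertificate
  rw [h3, hQ hv, hQ hw, hQ hx, e1, hB]
  generalize u - q ^ k * q⁻¹ = u1 at *
  generalize 1 - a * v * q ^ k = v2 at *
  generalize 1 - a * w * q ^ k = w2 at *
  generalize 1 - a * x * q ^ k = x2 at *
  ring

theorem summable_vwpCertificate (hq0 : q ≠ 0) (hq1 : ‖q‖ < 1) (ha : a ≠ 0)
    (hu : IsRegularParam a q u) (hv : IsRegularParam a q v) (hw : IsRegularParam a q w)
    (hx : IsRegularParam a q x) (hs : Summable (vwpTerm a q u v w x)) :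
    Summable (vwpCertificate a q u v w x) := by
  rcases eq_or_ne u 0 with rfl | hu0
  · have : vwpCertificate a q 0 v w x = 0 := by
      funext k
      simp [vwpCertificate]
    rw [this]
    exact summable_zero
  have key := vwpCertificate_mul_eq hq0 hu hv hw hx
  refine summable_int_of_mul_eq hq1
    (d := fun t => (q * u - t) * (1 - a * t ^ 2))
    (m := fun t => (1 - a * u * q) * (1 - q * u) * u * q *
        ((1 - a * v * t) * (1 - a * w * t) * (1 - a * x * t)))
    (d' := fun s => (q * u * s - 1) * (s ^ 2 - a))
    (m' := fun s => (1 - a * u * q) * (1 - q * u) * u * q *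
        ((s - a * v) * (s - a * w) * (s - a * x)))
    (by fun_prop) (by fun_prop) (by simp [hq0, hu0]) (by fun_prop) (by fun_prop)
    (by simp [ha]) hs ?_ ?_
  · intro n
    simpa using key n
  · intro n
    have h := key (-n)
    have h0 := pow_ne_zero n hq0
    rw [zpow_neg, zpow_natCast] at h
    generalize q ^ n = s at *
    generalize vwpCertificate a q u v w x (-n) = T1 at *
    generalize vwpTerm a q u v w x (-n) = T2 at *
    have h1 : q * u - s⁻¹ = (q * u * s - 1) * s⁻¹ := by field_simp
    have h2 : 1 - a * s⁻¹ ^ 2 = (s ^ 2 - a) * s⁻¹ ^ 2 := by field_simp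
    have h3 (y : ℂ) : 1 - a * y * s⁻¹ = (s - a * y) * s⁻¹ := by field_simp
    rw [h1, h2, h3, h3, h3] at h
    apply mul_right_cancel₀ (pow_ne_zero 3 (inv_ne_zero h0))
    linear_combination h

theorem mul_tsum_eq_of_telescoping {f g h : ℤ → ℂ} (α β : ℂ) (hf : Summable f) (hg : Summable g)
    (hh : Summable h) (H : ∀ k, α * f k - β * g k = h k - h (k + 1)) :
    α * ∑' k : ℤ, f k = β * ∑' k : ℤ, g k := by
  have hh' : Summable fun k => h (k + 1) := (Equiv.addRight (1 : ℤ)).summable_iff.mpr hh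
  rw [← tsum_mul_left, ← tsum_mul_left, ← sub_eq_zero,
    ← (hf.mul_left α).tsum_sub (hg.mul_left β), tsum_congr H, hh.tsum_sub hh', sub_eq_zero]
  exact ((Equiv.addRight (1 : ℤ)).tsum_eq h).symm

/-- The contiguous relation for the sum of the series, obtained by telescoping. -/
theorem tsum_vwpTerm_contiguous (hq0 : q ≠ 0) (hq1 : ‖q‖ < 1) (ha : a ≠ 0)
    (hu : IsRegularParam a q u) (hv : IsRegularParam a q v) (hw : IsRegularParam a q w)
    (hx : IsRegularParam a q x) (hs : Summable (vwpTerm a q u v w x)) :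
    (1 - a * u * q) * (1 - q * u) * (1 - a ^ 2 * q * (u * v * w * x)) *
        ∑' k : ℤ, vwpTerm a q u v w x k =
      (1 - a * q * (u * v)) * (1 - a * q * (u * w)) * (1 - a * q * (u * x)) *
        ∑' k : ℤ, vwpTerm a q (q * u) v w x k := by
  exact mul_tsum_eq_of_telescoping _ _ hs (summable_vwpTerm_base_mul hq0 hq1 ha hu hs)
    (summable_vwpCertificate hq0 hq1 ha hu hv hw hx hs) (vwpTerm_contiguous hq0 ha hu hv hw hx)

theorem continuousAt_vwpFactor_natCast {s₀ : ℂ} (h : IsRegularParam a q (s₀ * u)) (n : ℕ) :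
    ContinuousAt (fun s => vwpFactor a q (s * u) n) s₀ := by
  induction n with
  | zero => simpa [vwpFactor_zero] using continuousAt_const
  | succ n ih =>
    simp only [vwpFactor_natCast_succ]
    refine ContinuousAt.mul (ContinuousAt.div (by fun_prop) (by fun_prop) ?_) ih
    exact sub_ne_zero.mpr (h.mul_ne_one n).symm

theorem continuousAt_vwpTerm_natCast {s₀ : ℂ} (hu : IsRegularParam a q (s₀ * u))
    (hv : IsRegularParam a q (s₀ * v)) (hw : IsRegularParam a q (s₀ * w))
    (hx : IsRegularParam a q (s₀ * x)) (n : ℕ) :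
    ContinuousAt (fun s => vwpTerm a q (s * u) (s * v) (s * w) (s * x) n) s₀ := by
  simp only [vwpTerm]
  have h1 := continuousAt_vwpFactor_natCast hu n
  have h2 := continuousAt_vwpFactor_natCast hv n
  have h3 := continuousAt_vwpFactor_natCast hw n
  have h4 := continuousAt_vwpFactor_natCast hx n
  exact (continuousAt_const.mul (((h1.mul h2).mul h3).mul h4)).mul continuousAt_const

theorem continuousAt_vwpRatio (s₀ : ℂ) :
    ContinuousAt (fun p : ℂ × ℂ => vwpRatio a q (p.1 * u) (p.1 * v) (p.1 * w) (p.1 * x) p.2)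
      (s₀, 0) := by
  unfold vwpRatio
  refine ContinuousAt.mul (ContinuousAt.mul (ContinuousAt.div ?_ ?_ ?_) ?_)
    (ContinuousAt.mul (ContinuousAt.mul (ContinuousAt.mul (ContinuousAt.div ?_ ?_ ?_)
      (ContinuousAt.div ?_ ?_ ?_)) (ContinuousAt.div ?_ ?_ ?_)) (ContinuousAt.div ?_ ?_ ?_))
  all_goals first | fun_prop | simp

/-- The terms with nonnegative index are dominated by a convergent series, uniformly for nearby
parameters: by the continuity of `vwpRatio`, the quotients of consecutive terms of large index stay
below a constant less than `1`. -/
theorem exists_summable_bound_natCast (hq1 : ‖q‖ < 1) (ha : ∀ n : ℤ, a ≠ q ^ (2 * n)) {s₀ : ℂ}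
    (hu : IsRegularParam a q (s₀ * u)) (hv : IsRegularParam a q (s₀ * v))
    (hw : IsRegularParam a q (s₀ * w)) (hx : IsRegularParam a q (s₀ * x))
    (hz : ‖a ^ 2 * q * (s₀ * u * (s₀ * v) * (s₀ * w) * (s₀ * x))‖ < 1) :
    ∃ B : ℕ → ℝ, Summable B ∧ ∀ᶠ s in 𝓝 s₀, ∀ n : ℕ,
      ‖vwpTerm a q (s * u) (s * v) (s * w) (s * x) n‖ ≤ B n := by
  obtain ⟨ρ, hρz, hρ1⟩ := exists_between hz
  have hρ0 : 0 ≤ ρ := (norm_nonneg _).trans hρz.le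
  have hR := (continuousAt_vwpRatio (a := a) (q := q) (u := u) (v := v) (w := w) (x := x) s₀).norm
  have hev : ∀ᶠ p : ℂ × ℂ in 𝓝 (s₀, 0),
      ‖vwpRatio a q (p.1 * u) (p.1 * v) (p.1 * w) (p.1 * x) p.2‖ < ρ :=
    hR.eventually_lt_const (by simpa [vwpRatio] using hρz)
  rw [nhds_prod_eq, eventually_prod_iff] at hev
  obtain ⟨pa, hpa, pb, hpb, hab⟩ := hev
  have hq := tendsto_pow_atTop_nhds_zero_of_norm_lt_one hq1
  obtain ⟨K, hK⟩ := eventually_atTop.mp (hq.eventually hpb)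
  set b : ℕ → ℝ := fun i => ‖vwpTerm a q (s₀ * u) (s₀ * v) (s₀ * w) (s₀ * x) i‖ + 1 with hb
  have hb0 (i : ℕ) : 0 ≤ b i := by positivity
  set C : ℝ := ∑ i ∈ Finset.range (K + 1), b i with hC
  have hbC (i : ℕ) (hi : i ≤ K) : b i ≤ C :=
    Finset.single_le_sum (f := b) (fun i _ => hb0 i) (Finset.mem_range.mpr (by omega))
  -- The subtraction is truncated: the bound is the constant `C` up to the index `K`.
  refine ⟨fun n => C * ρ ^ (n - K), ?_, ?_⟩
  · rw [← summable_nat_add_iff K]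
    simpa using (summable_geometric_of_lt_one hρ0 hρ1).mul_left C
  have hsmall : ∀ᶠ s in 𝓝 s₀, ∀ i ∈ Finset.range (K + 1),
      ‖vwpTerm a q (s * u) (s * v) (s * w) (s * x) i‖ < b i := by
    rw [Finset.eventually_all]
    intro i _
    exact (continuousAt_vwpTerm_natCast hu hv hw hx i).norm.eventually_lt_const (lt_add_one _)
  filter_upwards [hpa, hsmall] with s hs1 hs2 n
  rcases le_or_gt n K with hn | hn
  · rw [Nat.sub_eq_zero_of_le hn, pow_zero, mul_one]
    exact (hs2 n (Finset.mem_range.mpr (by omega))).le.trans (hbC n hn)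
  · obtain ⟨m, rfl⟩ := Nat.exists_eq_add_of_le hn.le
    clear hn
    rw [Nat.add_sub_cancel_left]
    induction m with
    | zero =>
      rw [pow_zero, mul_one]
      exact (hs2 K (Finset.mem_range.mpr (by omega))).le.trans (hbC K le_rfl)
    | succ m ih =>
      rw [← add_assoc, vwpTerm_natCast_succ ha, norm_mul, pow_succ']
      calc _ ≤ ρ * (C * ρ ^ m) :=
            mul_le_mul (hab hs1 (hK _ (by omega))).le ih (norm_nonneg _) hρ0
        _ = _ := by ring

end Convergence

/-! ### Bilateral bounds and infinite products -/

section BilateralConvergence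

variable {a q u v w x : ℂ}

/-- The two-sided form of `exists_summable_bound_natCast`: the terms with negative index are
reduced to those with positive index by `vwpTerm_neg`. -/
theorem exists_summable_bound (hq0 : q ≠ 0) (hq1 : ‖q‖ < 1) (ha0 : a ≠ 0)
    (ha : ∀ n : ℤ, a ≠ q ^ (2 * n)) {s₀ : ℂ}
    (hu : IsRegularParam a q (s₀ * u)) (hv : IsRegularParam a q (s₀ * v))
    (hw : IsRegularParam a q (s₀ * w)) (hx : IsRegularParam a q (s₀ * x))
    (hz : ‖a ^ 2 * q * (s₀ * u * (s₀ * v) * (s₀ * w) * (s₀ * x))‖ < 1) :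
    ∃ B : ℤ → ℝ, Summable B ∧ ∀ᶠ s in 𝓝 s₀,
      IsRegularParam a q (s * u) → IsRegularParam a q (s * v) → IsRegularParam a q (s * w) →
      IsRegularParam a q (s * x) → ∀ k : ℤ,
      ‖vwpTerm a q (s * u) (s * v) (s * w) (s * x) k‖ ≤ B k := by
  have ha1 : a ≠ 1 := by simpa using ha 0
  have ha' (n : ℤ) : a⁻¹ ≠ q ^ (2 * n) := fun e => ha (-n) (by
    rw [mul_neg, zpow_neg, ← e, inv_inv])
  obtain ⟨B₁, hB₁, h₁⟩ := exists_summable_bound_natCast hq1 ha hu hv hw hx hz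
  obtain ⟨B₂, hB₂, h₂⟩ := exists_summable_bound_natCast (a := a⁻¹) (q := q) (s₀ := s₀)
    (u := a * u) (v := a * v) (w := a * w) (x := a * x) hq1 ha'
    (by rw [mul_left_comm]; exact hu.reflect ha0) (by rw [mul_left_comm]; exact hv.reflect ha0)
    (by rw [mul_left_comm]; exact hw.reflect ha0) (by rw [mul_left_comm]; exact hx.reflect ha0)
    (by convert hz using 2; field_simp)
  -- Both bounds are nonnegative, because they hold at `s₀` itself.
  have hB₁0 (n : ℕ) : 0 ≤ B₁ n := (norm_nonneg _).trans (h₁.self_of_nhds n)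
  have hB₂0 (n : ℕ) : 0 ≤ B₂ n := (norm_nonneg _).trans (h₂.self_of_nhds n)
  refine ⟨fun k => B₁ k.natAbs + B₂ k.natAbs,
    .of_nat_of_neg (by simpa using hB₁.add hB₂) (by simpa using hB₁.add hB₂), ?_⟩
  filter_upwards [h₁, h₂] with s hs₁ hs₂ hus hvs hws hxs k
  obtain ⟨n, rfl | rfl⟩ := k.eq_nat_or_neg
  · simpa using (hs₁ n).trans (le_add_of_nonneg_right (hB₂0 n))
  · rw [vwpTerm_neg hq0 ha0 ha1 hus hvs hws hxs]
    simp only [mul_left_comm a s, Int.natAbs_neg, Int.natAbs_natCast]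
    exact (hs₂ n).trans (le_add_of_nonneg_left (hB₁0 n))

theorem summable_vwpTerm (hq0 : q ≠ 0) (hq1 : ‖q‖ < 1) (ha0 : a ≠ 0)
    (ha : ∀ n : ℤ, a ≠ q ^ (2 * n)) (hu : IsRegularParam a q u) (hv : IsRegularParam a q v)
    (hw : IsRegularParam a q w) (hx : IsRegularParam a q x)
    (hz : ‖a ^ 2 * q * (u * v * w * x)‖ < 1) : Summable (vwpTerm a q u v w x) := by
  obtain ⟨B, hB, h⟩ := exists_summable_bound (s₀ := 1) (u := u) (v := v) (w := w) (x := x) hq0 hq1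
    ha0 ha (by simpa using hu) (by simpa using hv) (by simpa using hw) (by simpa using hx)
    (by simpa using hz)
  have h' := h.self_of_nhds
  simp only [one_mul] at h'
  exact .of_norm_bounded hB (h' hu hv hw hx)

/-- The sum of the series is continuous at the origin along `(u, v, w, x) q ^ n`. -/
theorem tendsto_tsum_vwpTerm (hq0 : q ≠ 0) (hq1 : ‖q‖ < 1) (ha0 : a ≠ 0)
    (ha : ∀ n : ℤ, a ≠ q ^ (2 * n)) (hu : IsRegularParam a q u) (hv : IsRegularParam a q v)
    (hw : IsRegularParam a q w) (hx : IsRegularParam a q x) :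
    Tendsto (fun n : ℕ => ∑' k : ℤ, vwpTerm a q (q ^ n * u) (q ^ n * v) (q ^ n * w) (q ^ n * x) k)
      atTop (𝓝 (∑' k : ℤ, vwpTerm a q 0 0 0 0 k)) := by
  have ha1 : a ≠ 1 := by simpa using ha 0
  have hq := tendsto_pow_atTop_nhds_zero_of_norm_lt_one hq1
  have h0 (b y : ℂ) : IsRegularParam b q (0 * y) := by
    rw [zero_mul]; exact isRegularParam_zero
  have hlim (b u v w x : ℂ) (n : ℕ) : Tendsto (fun m : ℕ =>
      vwpTerm b q (q ^ m * u) (q ^ m * v) (q ^ m * w) (q ^ m * x) n) atTop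
      (𝓝 (vwpTerm b q 0 0 0 0 n)) := by
    have h := (continuousAt_vwpTerm_natCast (h0 b u) (h0 b v) (h0 b w) (h0 b x) n).tendsto.comp hq
    simp only [zero_mul] at h
    exact h
  obtain ⟨B, hB, h⟩ := exists_summable_bound (s₀ := 0) (u := u) (v := v) (w := w) (x := x) hq0 hq1
    ha0 ha (h0 a u) (h0 a v) (h0 a w) (h0 a x) (by simp)
  refine tendsto_tsum_of_dominated_convergence hB (fun k => ?_) ?_
  · obtain ⟨n, rfl | rfl⟩ := k.eq_nat_or_neg
    · exact hlim a u v w x n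
    · rw [vwpTerm_neg hq0 ha0 ha1 isRegularParam_zero isRegularParam_zero isRegularParam_zero
        isRegularParam_zero, mul_zero]
      refine (hlim a⁻¹ (a * u) (a * v) (a * w) (a * x) n).congr fun m => ?_
      rw [vwpTerm_neg hq0 ha0 ha1 (hu.mul m) (hv.mul m) (hw.mul m) (hx.mul m)]
      simp only [mul_left_comm a]
  · filter_upwards [hq.eventually h] with n hn
    exact hn (hu.mul n) (hv.mul n) (hw.mul n) (hx.mul n)

end BilateralConvergence

section InfiniteProducts

variable {q y : ℂ}

theorem qPochInf_ne_zero (hq1 : ‖q‖ < 1) (hy : ∀ n : ℕ, y * q ^ n ≠ 1) : qPochInf y q ≠ 0 := by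
  have h : Summable fun j : ℕ => ‖-(y * q ^ j)‖ := by
    simp only [norm_neg, norm_mul, norm_pow]
    exact (summable_geometric_of_lt_one (norm_nonneg q) hq1).mul_left _
  have := tprod_one_add_ne_zero_of_summable (f := fun j : ℕ => -(y * q ^ j))
    (fun j => by rw [← sub_eq_add_neg]; exact sub_ne_zero.mpr (hy j).symm) h
  simpa [qPochInf, sub_eq_add_neg] using this

theorem qPochInf_eq_zero (hq1 : ‖q‖ < 1) {n : ℕ} (hy : y * q ^ n = 1) : qPochInf y q = 0 := by
  rw [qPochInf_eq_prod_mul y q hq1 (n + 1), Finset.prod_range_succ, hy]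
  simp

theorem qPochInf_eq_mul (hq1 : ‖q‖ < 1) (y : ℂ) :
    qPochInf y q = (1 - y) * qPochInf (q * y) q := by
  simpa [mul_comm] using qPochInf_eq_prod_mul y q hq1 1

theorem qPochInf_zero : qPochInf 0 q = 1 := by simp [qPochInf]

theorem mul_pow_ne_one_of_norm_lt_one (hq1 : ‖q‖ < 1) (hy : ‖y‖ < 1) (n : ℕ) :
    y * q ^ n ≠ 1 := fun e => by
  have h1 : ‖y * q ^ n‖ < 1 := by
    rw [norm_mul, norm_pow]
    exact mul_lt_one_of_nonneg_of_lt_one_left (norm_nonneg _) hy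
      (pow_le_one₀ (norm_nonneg _) hq1.le)
  rw [e, norm_one] at h1
  exact lt_irrefl _ h1

theorem tendsto_qPochInf_pow_mul (hq1 : ‖q‖ < 1) (y : ℂ) {r : ℕ} (hr : r ≠ 0) :
    Tendsto (fun n : ℕ => qPochInf ((q ^ n) ^ r * y) q) atTop (𝓝 1) := by
  have hmain (y : ℂ) (hy : ∀ n : ℕ, y * q ^ n ≠ 1) :
      Tendsto (fun n : ℕ => qPochInf (y * q ^ n) q) atTop (𝓝 1) := by
    have hne := qPochInf_ne_zero hq1 hy
    have h := (multipliable_qPochInf y q hq1).hasProd.tendsto_prod_nat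
    have h' := (tendsto_const_nhds (x := qPochInf y q)).div h hne
    change Tendsto _ _ (𝓝 (qPochInf y q / qPochInf y q)) at h'
    rw [div_self hne] at h'
    refine h'.congr fun n => ?_
    have e := qPochInf_eq_prod_mul y q hq1 n
    have h0 : ∏ j ∈ Finset.range n, (1 - y * q ^ j) ≠ 0 := fun h0 => hne (by rw [e, h0, zero_mul])
    simp only [Pi.div_apply]
    rw [div_eq_iff h0, e]
    ring
  have hall : Tendsto (fun n : ℕ => qPochInf (y * q ^ n) q) atTop (𝓝 1) := by
    by_cases hy : ∀ n : ℕ, y * q ^ n ≠ 1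
    · exact hmain y hy
    · push Not at hy
      -- At most one factor vanishes, and it is absent from the products that start after it.
      obtain ⟨m, hm⟩ := hy
      have e (n : ℕ) : y * q ^ (n + (m + 1)) = q * q ^ n := by
        rw [pow_add, pow_succ]
        linear_combination q ^ n * q * hm
      rw [← tendsto_add_atTop_iff_nat (m + 1)]
      simp only [e]
      exact hmain q (mul_pow_ne_one_of_norm_lt_one hq1 hq1)
  refine (hall.comp (tendsto_id.atTop_mul_const' (Nat.pos_of_ne_zero hr))).congr fun n => ?_
  rw [Function.comp_apply, id_eq, pow_mul, mul_comm]

end InfiniteProducts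

/-! ### The summation in reciprocal parameters -/

section Summation

variable {a q u v w x : ℂ}

/-- The part of the denominator of the product side that depends on the parameters
`1 / u, 1 / v, 1 / w, 1 / x`. -/
noncomputable def vwpDenom (a q u v w x : ℂ) : ℂ :=
  qPochInf (a * u * q) q * qPochInf (a * v * q) q * qPochInf (a * w * q) q *
    qPochInf (a * x * q) q * (qPochInf (u * q) q * qPochInf (v * q) q * qPochInf (w * q) q *
    qPochInf (x * q) q) * qPochInf (a ^ 2 * q * (u * v * w * x)) q

/-- The part of the numerator of the product side that depends on the parameters
`1 / u, 1 / v, 1 / w, 1 / x`. -/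
noncomputable def vwpNumer (a q u v w x : ℂ) : ℂ :=
  qPochInf (a * q * (u * v)) q * qPochInf (a * q * (u * w)) q * qPochInf (a * q * (u * x)) q *
    qPochInf (a * q * (v * w)) q * qPochInf (a * q * (v * x)) q * qPochInf (a * q * (w * x)) q

/-- Multiplying `u` by `q` changes both sides of the summation formula by the same factor `c`. The
parameters are rotated so that four applications treat them all. -/
theorem exists_factor_rotate (hq0 : q ≠ 0) (hq1 : ‖q‖ < 1) (ha : a ≠ 0)
    (hu : IsRegularParam a q u) (hv : IsRegularParam a q v) (hw : IsRegularParam a q w)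
    (hx : IsRegularParam a q x) (hs : Summable (vwpTerm a q u v w x)) :
    Summable (vwpTerm a q v w x (q * u)) ∧ ∃ c : ℂ,
      (∑' k : ℤ, vwpTerm a q u v w x k) * vwpDenom a q u v w x =
        c * ((∑' k : ℤ, vwpTerm a q v w x (q * u) k) * vwpDenom a q v w x (q * u)) ∧
      vwpNumer a q u v w x = c * vwpNumer a q v w x (q * u) := by
  have hrot : vwpTerm a q v w x (q * u) = vwpTerm a q (q * u) v w x :=
    funext fun k => (vwpTerm_rotate a q (q * u) v w x k).symm
  rw [hrot]
  refine ⟨summable_vwpTerm_base_mul hq0 hq1 ha hu hs,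
    (1 - a * q * (u * v)) * (1 - a * q * (u * w)) * (1 - a * q * (u * x)), ?_, ?_⟩
  · have h := tsum_vwpTerm_contiguous hq0 hq1 ha hu hv hw hx hs
    have e1 := qPochInf_eq_mul hq1 (a * u * q)
    have e2 := qPochInf_eq_mul hq1 (u * q)
    have e3 := qPochInf_eq_mul hq1 (a ^ 2 * q * (u * v * w * x))
    have i1 : q * (a * u * q) = a * (q * u) * q := by ring
    have i2 : q * (u * q) = q * u * q := by ring
    have i3 : q * (a ^ 2 * q * (u * v * w * x)) = a ^ 2 * q * (v * w * x * (q * u)) := by ring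
    rw [i1] at e1
    rw [i2] at e2
    rw [i3] at e3
    unfold vwpDenom
    rw [e1, e2, e3]
    linear_combination (qPochInf (a * (q * u) * q) q * qPochInf (a * v * q) q *
      qPochInf (a * w * q) q * qPochInf (a * x * q) q * (qPochInf (q * u * q) q *
      qPochInf (v * q) q * qPochInf (w * q) q * qPochInf (x * q) q) *
      qPochInf (a ^ 2 * q * (v * w * x * (q * u))) q) * h
  · have e (y : ℂ) : qPochInf (a * q * (u * y)) q =
        (1 - a * q * (u * y)) * qPochInf (a * q * (y * (q * u))) q := by
      rw [qPochInf_eq_mul hq1 (a * q * (u * y))]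
      congr 2
      ring
    unfold vwpNumer
    rw [e v, e w, e x]
    ring

theorem exists_factor_base_mul (hq0 : q ≠ 0) (hq1 : ‖q‖ < 1) (ha : a ≠ 0)
    (hu : IsRegularParam a q u) (hv : IsRegularParam a q v) (hw : IsRegularParam a q w)
    (hx : IsRegularParam a q x) (hs : Summable (vwpTerm a q u v w x)) :
    Summable (vwpTerm a q (q * u) (q * v) (q * w) (q * x)) ∧ ∃ c : ℂ,
      (∑' k : ℤ, vwpTerm a q u v w x k) * vwpDenom a q u v w x =
        c * ((∑' k : ℤ, vwpTerm a q (q * u) (q * v) (q * w) (q * x) k) *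
          vwpDenom a q (q * u) (q * v) (q * w) (q * x)) ∧
      vwpNumer a q u v w x = c * vwpNumer a q (q * u) (q * v) (q * w) (q * x) := by
  have hmul {y : ℂ} (hy : IsRegularParam a q y) : IsRegularParam a q (q * y) := by
    simpa using hy.mul 1
  obtain ⟨s1, c1, h1, n1⟩ := exists_factor_rotate hq0 hq1 ha hu hv hw hx hs
  obtain ⟨s2, c2, h2, n2⟩ := exists_factor_rotate hq0 hq1 ha hv hw hx (hmul hu) s1
  obtain ⟨s3, c3, h3, n3⟩ := exists_factor_rotate hq0 hq1 ha hw hx (hmul hu) (hmul hv) s2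
  obtain ⟨s4, c4, h4, n4⟩ := exists_factor_rotate hq0 hq1 ha hx (hmul hu) (hmul hv) (hmul hw) s3
  refine ⟨s4, c1 * c2 * c3 * c4, ?_, ?_⟩
  · rw [h1, h2, h3, h4]
    ring
  · rw [n1, n2, n3, n4]
    ring

theorem exists_factor_pow_mul (hq0 : q ≠ 0) (hq1 : ‖q‖ < 1) (ha : a ≠ 0)
    (hu : IsRegularParam a q u) (hv : IsRegularParam a q v) (hw : IsRegularParam a q w)
    (hx : IsRegularParam a q x) (hs : Summable (vwpTerm a q u v w x)) (n : ℕ) :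
    Summable (vwpTerm a q (q ^ n * u) (q ^ n * v) (q ^ n * w) (q ^ n * x)) ∧ ∃ c : ℂ,
      (∑' k : ℤ, vwpTerm a q u v w x k) * vwpDenom a q u v w x =
        c * ((∑' k : ℤ, vwpTerm a q (q ^ n * u) (q ^ n * v) (q ^ n * w) (q ^ n * x) k) *
          vwpDenom a q (q ^ n * u) (q ^ n * v) (q ^ n * w) (q ^ n * x)) ∧
      vwpNumer a q u v w x =
        c * vwpNumer a q (q ^ n * u) (q ^ n * v) (q ^ n * w) (q ^ n * x) := by
  induction n with
  | zero => exact ⟨by simpa using hs, 1, by simp, by simp⟩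
  | succ n ih =>
    obtain ⟨s1, c1, h1, n1⟩ := ih
    obtain ⟨s2, c2, h2, n2⟩ := exists_factor_base_mul hq0 hq1 ha (hu.mul n) (hv.mul n) (hw.mul n)
      (hx.mul n) s1
    simp only [← mul_assoc, ← pow_succ'] at s2 h2 n2
    refine ⟨s2, c1 * c2, ?_, ?_⟩
    · rw [h1, h2]
      ring
    · rw [n1, n2, mul_assoc c1]

theorem tendsto_vwpDenom (hq1 : ‖q‖ < 1) (a u v w x : ℂ) :
    Tendsto (fun n : ℕ => vwpDenom a q (q ^ n * u) (q ^ n * v) (q ^ n * w) (q ^ n * x)) atTop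
      (𝓝 1) := by
  have h1 (y : ℂ) : Tendsto (fun n : ℕ => qPochInf (a * (q ^ n * y) * q) q) atTop (𝓝 1) :=
    (tendsto_qPochInf_pow_mul hq1 (a * y * q) one_ne_zero).congr fun n => by congr 1; ring
  have h2 (y : ℂ) : Tendsto (fun n : ℕ => qPochInf (q ^ n * y * q) q) atTop (𝓝 1) :=
    (tendsto_qPochInf_pow_mul hq1 (y * q) one_ne_zero).congr fun n => by congr 1; ring
  have h3 : Tendsto (fun n : ℕ => qPochInf (a ^ 2 * q *
      (q ^ n * u * (q ^ n * v) * (q ^ n * w) * (q ^ n * x))) q) atTop (𝓝 1) :=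
    (tendsto_qPochInf_pow_mul hq1 (a ^ 2 * q * (u * v * w * x)) four_ne_zero).congr fun n => by
      congr 1; ring
  have h := (((((h1 u).mul (h1 v)).mul (h1 w)).mul (h1 x)).mul
    ((((h2 u).mul (h2 v)).mul (h2 w)).mul (h2 x))).mul h3
  simp only [mul_one] at h
  exact h

theorem tendsto_vwpNumer (hq1 : ‖q‖ < 1) (a u v w x : ℂ) :
    Tendsto (fun n : ℕ => vwpNumer a q (q ^ n * u) (q ^ n * v) (q ^ n * w) (q ^ n * x)) atTop
      (𝓝 1) := by
  have h1 (y z : ℂ) : Tendsto (fun n : ℕ => qPochInf (a * q * (q ^ n * y * (q ^ n * z))) q)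
      atTop (𝓝 1) :=
    (tendsto_qPochInf_pow_mul hq1 (a * q * (y * z)) two_ne_zero).congr fun n => by congr 1; ring
  have h := (((((h1 u v).mul (h1 u w)).mul (h1 u x)).mul (h1 v w)).mul (h1 v x)).mul (h1 w x)
  simp only [mul_one] at h
  exact h

/-- The summation formula up to a factor that does not depend on the parameters: let `n` tend to
infinity in `exists_factor_pow_mul`. -/
theorem tsum_vwpTerm_mul_vwpDenom (hq0 : q ≠ 0) (hq1 : ‖q‖ < 1) (ha0 : a ≠ 0)
    (ha : ∀ n : ℤ, a ≠ q ^ (2 * n)) (hu : IsRegularParam a q u) (hv : IsRegularParam a q v)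
    (hw : IsRegularParam a q w) (hx : IsRegularParam a q x)
    (hs : Summable (vwpTerm a q u v w x)) :
    (∑' k : ℤ, vwpTerm a q u v w x k) * vwpDenom a q u v w x =
      vwpNumer a q u v w x * ∑' k : ℤ, vwpTerm a q 0 0 0 0 k := by
  have hS := tendsto_tsum_vwpTerm hq0 hq1 ha0 ha hu hv hw hx
  have hD := tendsto_vwpDenom hq1 a u v w x
  have hN := tendsto_vwpNumer hq1 a u v w x
  have h1 := hN.const_mul ((∑' k : ℤ, vwpTerm a q u v w x k) * vwpDenom a q u v w x)
  have h2 := (hS.mul hD).const_mul (vwpNumer a q u v w x)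
  rw [mul_one] at h1 h2
  refine tendsto_nhds_unique h1 (h2.congr fun n => ?_)
  obtain ⟨-, c, hc1, hc2⟩ := exists_factor_pow_mul hq0 hq1 ha0 hu hv hw hx hs n
  rw [hc1, hc2]
  ring

theorem vwpFactor_zero_param_pow_four (hq : q ≠ 0) (k : ℤ) :
    vwpFactor a q 0 k ^ 4 = q ^ (2 * k * (k - 1)) := by
  have h (k : ℤ) : vwpFactor a q 0 (k + 1) ^ 4 = q ^ (4 * k) * vwpFactor a q 0 k ^ 4 := by
    have := vwpFactor_mul_eq (a := a) hq isRegularParam_zero k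
    simp only [mul_zero, zero_mul, sub_zero, mul_one, zero_sub] at this
    rw [← this, mul_comm 4 k, zpow_mul]
    norm_cast
    ring
  induction k with
  | zero => simp [vwpFactor_zero]
  | succ n ih =>
    rw [h, ih, ← zpow_add₀ hq]
    congr 1
    ring
  | pred n ih =>
    have := h (-n - 1)
    rw [sub_add_cancel, ih] at this
    apply mul_left_cancel₀ (zpow_ne_zero (4 * (-(n : ℤ) - 1)) hq)
    rw [← this, ← zpow_add₀ hq]
    congr 1
    ring

theorem vwpTerm_zero_params (hq : q ≠ 0) (k : ℤ) :
    vwpTerm a q 0 0 0 0 k =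
      (1 - a * q ^ (2 * k)) / (1 - a) * q ^ (2 * k * (k - 1)) * (a ^ 2 * q) ^ k := by
  rw [← vwpFactor_zero_param_pow_four (a := a) hq]
  simp only [vwpTerm]
  ring

/-- The case without parameters, which is Jacobi's triple product. Unless `a` is a power of `q`, it
follows from `tsum_vwpTerm_mul_vwpDenom` for parameters `1` and `1 / a` that leave only one nonzero
term; if `a = q ^ N`, both sides vanish, since the series changes sign under `k ↦ -N - k`. -/
theorem tsum_vwpTerm_zero_params (hq0 : q ≠ 0) (hq1 : ‖q‖ < 1) (ha0 : a ≠ 0)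
    (ha : ∀ n : ℤ, a ≠ q ^ (2 * n)) :
    ∑' k : ℤ, vwpTerm a q 0 0 0 0 k =
      qPochInf (a * q) q * qPochInf q q * qPochInf (q / a) q := by
  have ha1 : a ≠ 1 := by simpa using ha 0
  by_cases hN : ∃ N : ℤ, a = q ^ N
  · obtain ⟨N, rfl⟩ := hN
    have hl : ∑' k : ℤ, vwpTerm (q ^ N) q 0 0 0 0 k = 0 := by
      have h := (Equiv.subLeft (-N)).tsum_eq (vwpTerm (q ^ N) q 0 0 0 0)
      have hanti (k : ℤ) : vwpTerm (q ^ N) q 0 0 0 0 (Equiv.subLeft (-N) k) =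
          -vwpTerm (q ^ N) q 0 0 0 0 k := by
        have e (j : ℤ) : vwpTerm (q ^ N) q 0 0 0 0 j =
            (q ^ (2 * j ^ 2 - j + 2 * N * j) - q ^ (2 * j ^ 2 + j + 2 * N * j + N)) /
              (1 - q ^ N) := by
          have e1 : (((q ^ N) ^ 2 * q) : ℂ) ^ j = q ^ (2 * N * j + j) := by
            rw [← zpow_natCast, ← zpow_mul, ← zpow_add_one₀ hq0, ← zpow_mul]
            congr 1
            push_cast
            ring
          have e2 : q ^ (2 * j ^ 2 - j + 2 * N * j) =
              q ^ (2 * j * (j - 1)) * q ^ (2 * N * j + j) := by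
            rw [← zpow_add₀ hq0]; congr 1; ring
          have e3 : q ^ (2 * j ^ 2 + j + 2 * N * j + N) =
              q ^ N * q ^ (2 * j) * (q ^ (2 * j * (j - 1)) * q ^ (2 * N * j + j)) := by
            rw [← zpow_add₀ hq0, ← zpow_add₀ hq0, ← zpow_add₀ hq0]; congr 1; ring
          rw [vwpTerm_zero_params hq0, e1, e2, e3]
          ring
        rw [e, e, Equiv.subLeft_apply, ← neg_div, neg_sub]
        congr 3 <;> ring
      rw [tsum_congr hanti, tsum_neg] at h
      linear_combination (-1 / 2 : ℂ) * h
    have hr : qPochInf (q ^ N * q) q * qPochInf (q / q ^ N) q = 0 := by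
      have hN0 : N ≠ 0 := fun h0 => ha1 (by rw [h0, zpow_zero])
      rcases lt_or_gt_of_ne hN0 with h | h
      · rw [qPochInf_eq_zero hq1 (n := (-N - 1).toNat), zero_mul]
        rw [← zpow_natCast, Int.toNat_of_nonneg (by omega), ← zpow_add_one₀ hq0, ← zpow_add₀ hq0]
        simp
      · rw [qPochInf_eq_zero hq1 (y := q / q ^ N) (n := (N - 1).toNat), mul_zero]
        rw [← zpow_natCast, Int.toNat_of_nonneg (by omega), zpow_sub_one₀ hq0]
        field_simp
    rw [hl]
    linear_combination -(qPochInf q q) * hr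
  · push Not at hN
    have hpow (n : ℕ) : q ^ (n + 1) ≠ 1 := by
      simpa [pow_succ'] using mul_pow_ne_one_of_norm_lt_one hq1 hq1 n
    have hreg1 : IsRegularParam a q 1 := fun n => by
      refine ⟨by simpa using hpow n, fun e => hN (-(n + 1 : ℕ)) ?_⟩
      rw [zpow_neg, zpow_natCast]
      exact eq_inv_of_mul_eq_one_left (by simpa using e)
    have hreg2 : IsRegularParam a q a⁻¹ := fun n => by
      refine ⟨fun e => hN (n + 1 : ℕ) ?_, by simpa [ha0] using hpow n⟩
      rw [zpow_natCast]
      exact (inv_mul_eq_one₀ ha0).mp e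
    have hzero (k : ℤ) (hk : k ≠ 0) : vwpTerm a q 1 a⁻¹ 0 0 k = 0 := by
      obtain ⟨n, rfl | rfl⟩ := k.eq_nat_or_neg
      · -- The factor with index `0` of `∏ (1 - q ^ j)` vanishes.
        have h : recipPoch 1 q n = 0 := by
          rw [recipPoch_natCast]
          refine Finset.prod_eq_zero (i := 0) (Finset.mem_range.mpr ?_) (by simp)
          exact Nat.pos_of_ne_zero (by simpa using hk)
        simp [vwpTerm, vwpFactor, h]
      · -- Here `(q; q)_{-n}` is a pole.
        have h : (qPoch (a * a⁻¹ * q) q (-n))⁻¹ = 0 := by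
          rw [qPoch_neg, inv_inv]
          refine Finset.prod_eq_zero (i := 0) (Finset.mem_range.mpr ?_) (by simp [ha0, hq0])
          exact Nat.pos_of_ne_zero (by simpa using hk)
        simp only [vwpTerm, vwpFactor, h]
        ring
    have hs : Summable (vwpTerm a q 1 a⁻¹ 0 0) :=
      summable_of_ne_finset_zero (s := {0}) fun k hk => hzero k (by simpa using hk)
    have h := tsum_vwpTerm_mul_vwpDenom hq0 hq1 ha0 ha hreg1 hreg2 isRegularParam_zero
      isRegularParam_zero hs
    rw [tsum_eq_single 0 hzero, vwpTerm_zero ha1] at h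
    simp only [vwpDenom, vwpNumer, mul_zero, zero_mul, qPochInf_zero, mul_one, one_mul,
      mul_inv_cancel₀ ha0] at h
    have hqq : qPochInf q q ≠ 0 :=
      qPochInf_ne_zero hq1 (mul_pow_ne_one_of_norm_lt_one hq1 hq1)
    have e : a * q * a⁻¹ = q := by field_simp
    have e' : a⁻¹ * q = q / a := by field_simp
    rw [e, e'] at h
    apply mul_left_cancel₀ hqq
    rw [← h]
    ring

end Summation

/-! ### Translation to the `₆ψ₆` series -/

section Translation

variable {a q b x : ℂ}

theorem recipPoch_inv (hb : b ≠ 0) (k : ℤ) : recipPoch b⁻¹ q k = qPoch b q k * b⁻¹ ^ k := by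
  obtain ⟨n, rfl | rfl⟩ := k.eq_nat_or_neg
  · rw [recipPoch_natCast, qPoch_natCast, zpow_natCast]
    conv_rhs => rw [← Finset.card_range n, ← Finset.prod_const, Finset.card_range]
    rw [← Finset.prod_mul_distrib]
    refine Finset.prod_congr rfl fun j _ => ?_
    field_simp
  · rw [recipPoch_neg, qPoch_neg, zpow_neg, zpow_natCast, ← mul_inv]
    conv_rhs => rw [← Finset.card_range n, ← Finset.prod_const, Finset.card_range]
    rw [← Finset.prod_mul_distrib]
    congr 1
    refine Finset.prod_congr rfl fun j _ => ?_
    field_simp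

theorem qPoch_ne_zero (hx : ∀ m : ℤ, x * q ^ m ≠ 1) (k : ℤ) : qPoch x q k ≠ 0 := by
  obtain ⟨n, rfl | rfl⟩ := k.eq_nat_or_neg
  · rw [qPoch_natCast, Finset.prod_ne_zero_iff]
    intro j _
    have := hx j
    rw [zpow_natCast] at this
    exact sub_ne_zero.mpr this.symm
  · rw [qPoch_neg]
    refine inv_ne_zero (Finset.prod_ne_zero_iff.mpr fun j _ => ?_)
    have := hx (-(j + 1 : ℕ))
    rw [zpow_neg, zpow_natCast] at this
    exact sub_ne_zero.mpr this.symm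

theorem qPoch_mul_base_div (hx : ∀ m : ℤ, x * q ^ m ≠ 1) (hq : q ≠ 0) (k : ℤ) :
    qPoch (q * x) q k / qPoch x q k = (1 - x * q ^ k) / (1 - x) := by
  have hx' (n : ℕ) : x * q ^ n ≠ 1 := by simpa using hx n
  have h1 := inv_qPoch_mul_base hq hx' k
  have h2 := inv_qPoch_eq_mul hx' k
  have h3 := qPoch_ne_zero hx (k + 1)
  rw [div_eq_mul_inv, h2, mul_comm q x, ← inv_inv (qPoch (x * q) q k), h1]
  field_simp

theorem psiTerm_eq_vwpTerm {s c d e : ℂ} (hq : q ≠ 0) (hs : s ^ 2 = a)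
    (ha : ∀ n : ℤ, a ≠ q ^ (2 * n)) (hb : b ≠ 0) (hc : c ≠ 0) (hd : d ≠ 0) (he : e ≠ 0) :
    psiTerm [q * s, -(q * s), b, c, d, e] [s, -s, a * q / b, a * q / c, a * q / d, a * q / e] q
      (a ^ 2 * q / (b * c * d * e)) = vwpTerm a q b⁻¹ c⁻¹ d⁻¹ e⁻¹ := by
  have hpow {y : ℂ} (hy : y ^ 2 = a) (m : ℤ) : y * q ^ m ≠ 1 := fun h => ha (-m) (by
    have : y = q ^ (-m) := by rw [zpow_neg]; exact eq_inv_of_mul_eq_one_left h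
    rw [← hy, this, mul_comm 2, zpow_mul]
    norm_cast)
  funext k
  have h1 := qPoch_mul_base_div (hpow hs) hq k
  have h2 := qPoch_mul_base_div (hpow ((neg_sq s).trans hs)) hq k
  have h3 : (1 - s * q ^ k) / (1 - s) * ((1 - -s * q ^ k) / (1 - -s)) =
      (1 - a * q ^ (2 * k)) / (1 - a) := by
    rw [div_mul_div_comm, mul_comm 2, zpow_mul, ← hs]
    norm_cast
    congr 1 <;> ring
  have hz : (a ^ 2 * q / (b * c * d * e)) ^ k =
      (a ^ 2 * q) ^ k * (b⁻¹ ^ k * c⁻¹ ^ k * d⁻¹ ^ k * e⁻¹ ^ k) := by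
    rw [← mul_zpow, ← mul_zpow, ← mul_zpow, ← mul_zpow]
    congr 1
    field_simp
  have hl (y : ℂ) : a * q / y = a * y⁻¹ * q := by rw [div_eq_mul_inv]; ring
  unfold psiTerm vwpTerm vwpFactor
  rw [recipPoch_inv hb, recipPoch_inv hc, recipPoch_inv hd, recipPoch_inv he, ← h3, ← h1, ← h2, hz]
  simp only [qPochList, List.map_cons, List.map_nil, List.prod_cons, List.prod_nil,
    List.length_cons, List.length_nil, sub_self, zpow_zero, mul_neg, hl]
  simp only [div_eq_mul_inv, mul_inv, mul_one]
  ring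

theorem isRegularParam_inv (hb : b ≠ 0) (h1 : ∀ n : ℕ, b ≠ q ^ (n + 1))
    (h2 : ∀ n : ℕ, a * q / b * q ^ n ≠ 1) : IsRegularParam a q b⁻¹ := fun n =>
  ⟨fun e => h1 n ((inv_mul_eq_one₀ hb).mp e), fun e => h2 n (by rw [← e]; ring)⟩

end Translation

theorem mainTheorem1 (q a s b c d e : ℂ)
    (hq0 : 0 < ‖q‖) (hq1 : ‖q‖ < 1)
    (ha0 : a ≠ 0) (hs : s ^ 2 = a)
    (ha : ∀ n : ℤ, a ≠ q ^ (2 * n))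
    (hx0 : ∀ x ∈ [b, c, d, e], x ≠ 0)
    (hupper : ∀ x ∈ [b, c, d, e], ∀ n : ℕ, x ≠ q ^ (n + 1))
    (hlower : ∀ x ∈ [b, c, d, e], ∀ n : ℕ, a * q / x * q ^ n ≠ 1)
    (hconv : ‖a ^ 2 * q / (b * c * d * e)‖ < 1 ∨
      (PsiTerminates [q * s, -(q * s), b, c, d, e]
          [s, -s, a * q / b, a * q / c, a * q / d, a * q / e] q
          (a ^ 2 * q / (b * c * d * e)) ∧
        ∀ n : ℕ, a ^ 2 * q / (b * c * d * e) * q ^ n ≠ 1)) :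
    Summable (psiTerm [q * s, -(q * s), b, c, d, e]
        [s, -s, a * q / b, a * q / c, a * q / d, a * q / e] q
        (a ^ 2 * q / (b * c * d * e))) ∧
    psi [q * s, -(q * s), b, c, d, e]
        [s, -s, a * q / b, a * q / c, a * q / d, a * q / e] q
        (a ^ 2 * q / (b * c * d * e)) =
      qPochInfList [a * q, a * q / (b * c), a * q / (b * d), a * q / (b * e), a * q / (c * d),
          a * q / (c * e), a * q / (d * e), q, q / a] q /
        qPochInfList [a * q / b, a * q / c, a * q / d, a * q / e, q / b, q / c, q / d, q / e,
          a ^ 2 * q / (b * c * d * e)] q := by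
  have hq : q ≠ 0 := norm_pos_iff.mp hq0
  simp only [List.forall_mem_cons] at hx0 hupper hlower
  obtain ⟨hb, hc, hd, he, -⟩ := hx0
  obtain ⟨ub, uc, ud, ue, -⟩ := hupper
  obtain ⟨lb, lc, ld, le, -⟩ := hlower
  have rb := isRegularParam_inv hb ub lb
  have rc := isRegularParam_inv hc uc lc
  have rd := isRegularParam_inv hd ud ld
  have re := isRegularParam_inv he ue le
  have hz : a ^ 2 * q / (b * c * d * e) = a ^ 2 * q * (b⁻¹ * c⁻¹ * d⁻¹ * e⁻¹) := by field_simp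
  have hterm := psiTerm_eq_vwpTerm hq hs ha hb hc hd he
  unfold psi PsiTerminates at *
  rw [hterm] at hconv ⊢
  have hsum : Summable (vwpTerm a q b⁻¹ c⁻¹ d⁻¹ e⁻¹) := by
    rcases hconv with h | ⟨h, -⟩
    · exact summable_vwpTerm hq hq1 ha0 ha rb rc rd re (by rwa [← hz])
    · exact summable_of_hasFiniteSupport h
  have hzne : qPochInf (a ^ 2 * q * (b⁻¹ * c⁻¹ * d⁻¹ * e⁻¹)) q ≠ 0 := by
    rw [← hz]
    rcases hconv with h | ⟨-, h⟩
    · exact qPochInf_ne_zero hq1 (mul_pow_ne_one_of_norm_lt_one hq1 h)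
    · exact qPochInf_ne_zero hq1 h
  refine ⟨hsum, ?_⟩
  have h := tsum_vwpTerm_mul_vwpDenom hq hq1 ha0 ha rb rc rd re hsum
  rw [tsum_vwpTerm_zero_params hq hq1 ha0 ha] at h
  have hne1 {y : ℂ} (hy : IsRegularParam a q y) : qPochInf (a * y * q) q ≠ 0 :=
    qPochInf_ne_zero hq1 hy.mul_ne_one
  have hne2 {y : ℂ} (hy : IsRegularParam a q y) : qPochInf (y * q) q ≠ 0 :=
    qPochInf_ne_zero hq1 fun n e => (hy n).1 (by rw [← e]; ring)
  have hden : vwpDenom a q b⁻¹ c⁻¹ d⁻¹ e⁻¹ ≠ 0 := by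
    simp only [vwpDenom, ne_eq, mul_eq_zero, hne1 rb, hne1 rc, hne1 rd, hne1 re, hne2 rb, hne2 rc,
      hne2 rd, hne2 re, hzne, or_self, not_false_eq_true]
  have i1 (y : ℂ) : a * q / y = a * y⁻¹ * q := by rw [div_eq_mul_inv]; ring
  have i2 (y : ℂ) : q / y = y⁻¹ * q := by rw [div_eq_mul_inv, mul_comm]
  have i3 (y z : ℂ) : a * q / (y * z) = a * q * (y⁻¹ * z⁻¹) := by rw [div_eq_mul_inv, mul_inv]
  have hden' : qPochInfList [a * q / b, a * q / c, a * q / d, a * q / e, q / b, q / c, q / d, q / e,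
      a ^ 2 * q / (b * c * d * e)] q = vwpDenom a q b⁻¹ c⁻¹ d⁻¹ e⁻¹ := by
    rw [hz, i1, i1, i1, i1, i2, i2, i2, i2]
    simp only [qPochInfList, vwpDenom, List.map_cons, List.map_nil, List.prod_cons, List.prod_nil]
    ring
  rw [hden', eq_div_iff hden, h, i3, i3, i3, i3, i3, i3]
  simp only [qPochInfList, vwpNumer, List.map_cons, List.map_nil, List.prod_cons, List.prod_nil]
  ring
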